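/- **The calculus.** Let $a$ range over channel names and let labels be $l^s$ with $l$ an atomic label and $s\in\{0,1\}^*$ ($l$ stands for $l^\epsilon$). Prefixes are $\alpha::=a\mid\bar a\mid\tau$; processes are $$P,Q::=l^s{:}\alpha.P\mid P\,|\,Q\mid P+Q\mid l^s{:}\textstyle\sum_i p_iP_i\mid(\nu a)P\mid\,!P\mid 0\mid l^s{:}\{P\}$$ (finite sums with $\sum_ip_i=1$); schedulers are the finite and infinite terms $S,T::=0\mid\sigma(L).S\mid\sigma(L_1,L_2).S\mid\sum_iS_i$ (finite sums). A complete process $P\parallel S,T$ has a main scheduler $S$ and an independent scheduler $T$. It is a probabilistic automaton with the usual CCS rules, in which $S$ determines by its labels which prefix or probabilistic choice is performed: $l{:}\alpha.P\parallel\sigma(l).S,T\xrightarrow{\alpha}\delta(P\parallel S,T)$; $l{:}\sum_ip_iP_i\parallel\sigma(l).S,T\xrightarrow{\tau}\sum_i[p_i]\delta(P_i\parallel S,T)$; $\sigma(l_1,l_2).S$ synchronizes, in a parallel composition, an input labelled $l_1$ with the matching output labelled $l_2$, giving $\tau$; the rules for $|$, $+$, $(\nu a)$ are the standard ones, and a copy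 unfolded from $!P$ is relabelled so that its labels are new. A scheduler $\sum_iS_i$ acts as its first operand $S_i$ that enables a transition of the complete process. A protected process is scheduled by $T$: if $P\parallel T\xrightarrow{\alpha}\mu$ (semantics with the single scheduler $T$), then $l{:}\{P\}\parallel\sigma(l).S,T\xrightarrow{\alpha}\mu'$ with $\mu'(P'\parallel S,T')=\mu(P'\parallel T')$. **The protocol.** Values are bits; $l{:}c(x).P$ abbreviates $l{:}c0.P[0/x]+l{:}c1.P[1/x]$, where $c0,c1$ are two channel names, and $l{:}\bar c\langle v\rangle$ abbreviates $l{:}\overline{cv}.0$. Write $[i=n]$ for $1$ if $i=n$ and $0$ otherwise; indices are modulo $3$ and addition of bits is modulo $2$. For $i\in\{0,1,2\}$ let $$M_i=l_2{:}\bar m_0\langle[i=0]\rangle\,|\,l_3{:}\bar m_1\langle[i=1]\rangle\,|\,l_4{:}\bar m_2\langle[i=2]\rangle,\qquad Choice=\textstyle\sum_{i=0}^2l_{12,i}{:}\tau.M_i,\qquad Master=l_1{:}\{Choice\},$$ $$Crypt_i=l_{5,i}{:}m_i(pay).\,l_{6,i}{:}c_{i,i}(x).\,l_{7,i}{:}c_{i,i+1}(y).\,l_{8,i}{:}\overline{out}_i\langle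 pay+x+y\rangle,$$ $$Coin_i=l_{9,i}{:}\big((l_{10,i}{:}\bar c_{i,i}\langle0\rangle\,|\,l_{11,i}{:}\bar c_{i-1,i}\langle0\rangle)+_{1/2}(l_{10,i}{:}\bar c_{i,i}\langle1\rangle\,|\,l_{11,i}{:}\bar c_{i-1,i}\langle1\rangle)\big),$$ $$Prot=(\nu\vec m)\big(Master\,|\,(\nu\vec c)(Crypt_0\,|\,Crypt_1\,|\,Crypt_2\,|\,Coin_0\,|\,Coin_1\,|\,Coin_2)\big),$$ where all names of the channels $m_i$ and $c_{i,j}$ are restricted. An independent scheduler $T$ *selects culprit* $i$ if $Choice\parallel T\xrightarrow{\tau}\delta(M_i\parallel T')$ for some $T'$. An observable is a finite sequence $\vec o$ of announcements $\overline{out}_i\langle v\rangle$, and $p_{S,T}(\vec o)$ is the probability of the maximal executions of $Prot\parallel S,T$ whose sequence of visible actions is $\vec o$. **Proposition (strong probabilistic anonymity of the dining cryptographers with nondeterministic selection of the culprit).** For all schedulers $S,T$ the automaton $Prot\parallel S,T$ is fully probabilistic, that is, at most one transition is available from each reachable state (so that $p_{S,T}$ is well defined). For every observable $\vec o$, every scheduler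 $S$ and all independent schedulers $T_1,T_2$ that select different culprits, $$p_{S,T_1}(\vec o)=p_{S,T_2}(\vec o).$$ -/

import Mathlib

open scoped ENNReal

namespace CCS

/-! ## Probabilistic automata -/

/-- A simple probabilistic automaton with states `Q` and actions `A`: an initial state and a
transition relation between states, actions and discrete probability measures on states. -/
structure ProbAutomaton (Q A : Type) where
  start : Q
  trans : Q → A → PMF Q → Prop

namespace ProbAutomaton

variable {Q A : Type}

/-- The states that occur in some execution. -/
inductive Reachable (M : ProbAutomaton Q A) : Q → Prop
  | start : Reachable M M.start
  | step {s : Q} {a : A} {μ : PMF Q} {s' : Q} :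
      Reachable M s → M.trans s a μ → s' ∈ μ.support → Reachable M s'

/-- From each (reachable) state at most one transition is available. -/
def FullyProbabilistic (M : ProbAutomaton Q A) : Prop :=
  ∀ s, M.Reachable s → ∀ a μ b ν, M.trans s a μ → M.trans s b ν → a = b ∧ μ = ν

/-- No transition is available from `s`. -/
def Terminal (M : ProbAutomaton Q A) (s : Q) : Prop :=
  ∀ a μ, ¬ M.trans s a μ

/-- The probability of moving from `s` to `s'` with action `a`. In a fully probabilistic automaton
there is at most one `μ` with `M.trans s a μ`; the value is then `μ s'`, and it is `0` if there is
no such `μ`. -/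
noncomputable def stepProb (M : ProbAutomaton Q A) (s : Q) (a : A) (s' : Q) : ℝ≥0∞ :=
  ⨆ (μ : PMF Q) (_ : M.trans s a μ), μ s'

/-- The probability of the finite execution `s a₁ s₁ a₂ s₂ …`, given by its start `s` and the list
of pairs `(aₖ, sₖ)`. -/
noncomputable def execProb (M : ProbAutomaton Q A) : Q → List (A × Q) → ℝ≥0∞
  | _, [] => 1
  | s, (a, s') :: e => M.stepProb s a s' * execProb M s' e

/-- The last state of a finite execution that starts in `s`. -/
def lastState : Q → List (A × Q) → Q
  | s, [] => s
  | _, (_, s') :: e => lastState s' e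

end ProbAutomaton

/-! ## Syntax of the calculus -/

/-- Prefixes over the channel names `C`: input `a`, output `ā`, and `τ`. -/
inductive Act (C : Type) : Type
  | inp (a : C)
  | out (a : C)
  | tau

/-- The visible part of an action: nothing for `τ`, the action itself otherwise. -/
def Act.visible {C : Type} : Act C → List (Act C)
  | .tau => []
  | .inp a => [.inp a]
  | .out a => [.out a]

/-- Labels `l^s`: an atomic label `l` and an index `s`, a finite string over `{0, 1}`
(`false` is `0`, `true` is `1`). -/
structure Label (L : Type) : Type where
  atom : L
  index : List Bool

/-- The label `l^ε`. -/
def Label.plain {L : Type} (l : L) : Label L := ⟨l, []⟩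

/-- Processes. `protect l P` is `l : {P}`, the process `P` whose scheduling is protected from the
main scheduler. In `prob l n p P` the weights `p` form a probability distribution on `Fin n`. -/
inductive Proc (C L : Type) : Type
  | pre (l : Label L) (α : Act C) (P : Proc C L)
  | par (P Q : Proc C L)
  | plus (P Q : Proc C L)
  | prob (l : Label L) (n : ℕ) (p : PMF (Fin n)) (P : Fin n → Proc C L)
  | nu (a : C) (P : Proc C L)
  | bang (P : Proc C L)
  | nil
  | protect (l : Label L) (P : Proc C L)

/-- Restriction on all the channels of a list. -/
def Proc.nus {C L : Type} (as : List C) (P : Proc C L) : Proc C L := as.foldr Proc.nu P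

/-- `l^s ↦ l^{sk}`. -/
def Label.extend {L : Type} (k : List Bool) (l : Label L) : Label L := ⟨l.atom, l.index ++ k⟩

/-- The relabelling `ρ_k`, which replaces every label `l^s` by `l^{sk}`. -/
def Proc.relabel {C L : Type} (k : List Bool) : Proc C L → Proc C L
  | .pre l α P => .pre (l.extend k) α (P.relabel k)
  | .par P Q => .par (P.relabel k) (Q.relabel k)
  | .plus P Q => .plus (P.relabel k) (Q.relabel k)
  | .prob l n p P => .prob (l.extend k) n p (fun i => (P i).relabel k)
  | .nu a P => .nu a (P.relabel k)
  | .bang P => .bang (P.relabel k)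
  | .nil => .nil
  | .protect l P => .protect (l.extend k) (P.relabel k)

/-- The selections a scheduler can make: `σ(l)` and `σ(l₁, l₂)`. -/
inductive Sel (L : Type) : Type
  | one (l : Label L)
  | sync (l₁ l₂ : Label L)

/-- The outermost operator of a scheduler. -/
inductive SchedShape (L : Type) : Type
  | nil
  | pre (h : Sel L)
  | sum (n : ℕ)

/-- The argument positions of an operator. -/
def SchedShape.Arg {L : Type} : SchedShape L → Type
  | .nil => Empty
  | .pre _ => Unit
  | .sum n => Fin n

/-- Schedulers: the finite and infinite terms over `S ::= 0 | σ(l).S | σ(l₁, l₂).S | ∑ᵢ Sᵢ`. -/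
def Sched (L : Type) : Type := PFunctor.M ⟨SchedShape L, SchedShape.Arg⟩

namespace Sched

variable {L : Type}

/-- The scheduler `0`. -/
def nil : Sched L := PFunctor.M.mk ⟨SchedShape.nil, fun x => Empty.elim x⟩

/-- The scheduler `σ(l).S` or `σ(l₁, l₂).S`. -/
def pre (h : Sel L) (S : Sched L) : Sched L := PFunctor.M.mk ⟨SchedShape.pre h, fun _ => S⟩

/-- The scheduler choice `∑ᵢ Sᵢ`. -/
def sum (n : ℕ) (S : Fin n → Sched L) : Sched L := PFunctor.M.mk ⟨SchedShape.sum n, S⟩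

/-- `S.Offers h S'`: `h.S'` is one of the alternatives of `S`, i.e. it is `S` itself or it is
reached from `S` by passing to operands of sums. -/
inductive Offers : Sched L → Sel L → Sched L → Prop
  | pre (h : Sel L) (S : Sched L) : Offers (pre h S) h S
  | sum {n : ℕ} {S : Fin n → Sched L} (i : Fin n) {h : Sel L} {S' : Sched L} :
      Offers (S i) h S' → Offers (sum n S) h S'

end Sched

/-! ## Semantics -/

variable {C L : Type}

/-- The transitions under a scheduler that starts with a selection. `k` is what the complete process
consists of beside the process once the selection is made: the continuation `S` when there is one
scheduler, the pair `(S, T)` of that continuation and the independent scheduler when there are two.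
So `Step I P h S α μ` reads `P ∥ h.S --α→ μ`, and `Step I P h (S, T) α μ` reads
`P ∥ h.S, T --α→ μ`. The relation `I P k α μ` says how the body `P` of a protected process is
scheduled. -/
inductive Step {K : Type} (I : Proc C L → K → Act C → PMF (Proc C L × K) → Prop) :
    Proc C L → Sel L → K → Act C → PMF (Proc C L × K) → Prop
  | act (l : Label L) (α : Act C) (P : Proc C L) (k : K) :
      Step I (.pre l α P) (.one l) k α (PMF.pure (P, k))
  | res {P : Proc C L} {h : Sel L} {k : K} {α : Act C} {μ : PMF (Proc C L × K)} (a : C) :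
      Step I P h k α μ → α ≠ .inp a → α ≠ .out a →
      Step I (.nu a P) h k α (μ.map fun x => (Proc.nu a x.1, x.2))
  | sum1 {P : Proc C L} {h : Sel L} {k : K} {α : Act C} {μ : PMF (Proc C L × K)} (Q : Proc C L) :
      Step I P h k α μ → Step I (.plus P Q) h k α μ
  | sum2 {Q : Proc C L} {h : Sel L} {k : K} {α : Act C} {μ : PMF (Proc C L × K)} (P : Proc C L) :
      Step I Q h k α μ → Step I (.plus P Q) h k α μ
  | par1 {P : Proc C L} {h : Sel L} {k : K} {α : Act C} {μ : PMF (Proc C L × K)} (Q : Proc C L) :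
      Step I P h k α μ → Step I (.par P Q) h k α (μ.map fun x => (Proc.par x.1 Q, x.2))
  | par2 {Q : Proc C L} {h : Sel L} {k : K} {α : Act C} {μ : PMF (Proc C L × K)} (P : Proc C L) :
      Step I Q h k α μ → Step I (.par P Q) h k α (μ.map fun x => (Proc.par P x.1, x.2))
  | com1 {P Q P' Q' : Proc C L} {l₁ l₂ : Label L} {k k' k'' : K} {a : C} :
      Step I P (.one l₁) k (.inp a) (PMF.pure (P', k')) →
      Step I Q (.one l₂) k' (.out a) (PMF.pure (Q', k'')) →
      Step I (.par P Q) (.sync l₁ l₂) k .tau (PMF.pure (.par P' Q', k''))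
  | com2 {P Q P' Q' : Proc C L} {l₁ l₂ : Label L} {k k' k'' : K} {a : C} :
      Step I Q (.one l₁) k (.inp a) (PMF.pure (Q', k')) →
      Step I P (.one l₂) k' (.out a) (PMF.pure (P', k'')) →
      Step I (.par P Q) (.sync l₁ l₂) k .tau (PMF.pure (.par P' Q', k''))
  | bang1 {P : Proc C L} {h : Sel L} {k : K} {α : Act C} {μ : PMF (Proc C L × K)} :
      Step I P h k α μ →
      Step I (.bang P) h k α
        (μ.map fun x => (Proc.par (x.1.relabel [false]) ((Proc.bang P).relabel [true]), x.2))
  | bang2 {P P₁ P₂ : Proc C L} {l₁ l₂ : Label L} {k k' k'' : K} {a : C} :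
      Step I P (.one l₁) k (.inp a) (PMF.pure (P₁, k')) →
      Step I P (.one l₂) k' (.out a) (PMF.pure (P₂, k'')) →
      Step I (.bang P) (.sync l₁ l₂) k .tau
        (PMF.pure (.par (.par (P₁.relabel [false]) (P₂.relabel [true, false]))
          ((Proc.bang P).relabel [true, true]), k''))
  | prob (l : Label L) (n : ℕ) (p : PMF (Fin n)) (P : Fin n → Proc C L) (k : K) :
      Step I (.prob l n p P) (.one l) k .tau (p.map fun i => (P i, k))
  | indep {l : Label L} {P : Proc C L} {k : K} {α : Act C} {μ : PMF (Proc C L × K)} :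
      I P k α μ → Step I (.protect l P) (.one l) k α μ

/-- Scheduler choice. `R h S α μ` is the transition relation under schedulers `h.S`; it is extended
to sums, where the first operand that enables a transition is taken, by the rule
`P ∥ Sᵢ --α→ μ` and `P ∥ Sⱼ ↛` for all `j < i` imply `P ∥ ∑ᵢ Sᵢ --α→ μ`. A scheduler enables no
transition when none of its alternatives does. -/
inductive Resolve {X : Type} (R : Sel L → Sched L → Act C → PMF X → Prop) :
    Sched L → Act C → PMF X → Prop
  | pre {h : Sel L} {S : Sched L} {α : Act C} {μ : PMF X} :
      R h S α μ → Resolve R (Sched.pre h S) α μ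
  | test {n : ℕ} {S : Fin n → Sched L} (i : Fin n) {α : Act C} {μ : PMF X} :
      Resolve R (S i) α μ →
      (∀ j < i, ∀ h S', (S j).Offers h S' → ∀ β ν, ¬ R h S' β ν) →
      Resolve R (Sched.sum n S) α μ

/-- `P ∥ S --α→ μ`, with one scheduler; a protected process is not scheduled by it. -/
def Trans₁ (P : Proc C L) (S : Sched L) (α : Act C) (μ : PMF (Proc C L × Sched L)) : Prop :=
  Resolve (fun h S' β ν => Step (fun _ _ _ _ => False) P h S' β ν) S α μ

/-- The body `P` of a protected process is scheduled by the independent scheduler `T`: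
`P ∥ S, T --α→ μ'` if `P ∥ T --α→ μ` and `μ'(P' ∥ S, T') = μ(P' ∥ T')`. -/
inductive Indep : Proc C L → Sched L × Sched L → Act C → PMF (Proc C L × Sched L × Sched L) → Prop
  | mk {P : Proc C L} {S T : Sched L} {α : Act C} {μ : PMF (Proc C L × Sched L)} :
      Trans₁ P T α μ → Indep P (S, T) α (μ.map fun x => (x.1, S, x.2))

/-- `P ∥ S, T --α→ μ`, with a main scheduler `S` and an independent scheduler `T`. -/
def Trans₂ (P : Proc C L) (S T : Sched L) (α : Act C)
    (μ : PMF (Proc C L × Sched L × Sched L)) : Prop :=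
  Resolve (fun h S' β ν => Step Indep P h (S', T) β ν) S α μ

/-- The automaton of the complete process `P ∥ S, T`. -/
def automaton (P : Proc C L) (S T : Sched L) :
    ProbAutomaton (Proc C L × Sched L × Sched L) (Act C) where
  start := (P, S, T)
  trans x α μ := Trans₂ x.1 x.2.1 x.2.2 α μ

/-- The sequence of visible actions of a finite execution. -/
def visibleTrace {Q : Type} (e : List (Act C × Q)) : List (Act C) :=
  e.flatMap fun x => x.1.visible

/-- The probability that a (fully probabilistic) automaton produces the sequence `w` of visible
actions: the total probability of the finite maximal executions whose visible actions are `w`. -/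
noncomputable def traceProb {Q : Type} (M : ProbAutomaton Q (Act C)) (w : List (Act C)) : ℝ≥0∞ :=
  ∑' e : {e : List (Act C × Q) //
      M.Terminal (ProbAutomaton.lastState M.start e) ∧ visibleTrace e = w},
    M.execProb M.start e.1

/-! ## The dining cryptographers -/

namespace DCP

/-- Channel names. Values are in `ZMod 2`, and each channel stands for a family of names indexed by
the value that is sent: `m i v`, `c i j v` and `out i v` are `m_i v`, `c_{i,j} v` and `out_i v`. -/
inductive Chan : Type
  | m (i : Fin 3) (v : ZMod 2)
  | c (i j : Fin 3) (v : ZMod 2)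
  | out (i : Fin 3) (v : ZMod 2)

/-- Atomic labels; an index in `Fin 3` is that of the cryptographer, the coin or the payer. -/
inductive Lab : Type
  | l1 | l2 | l3 | l4
  | l5 (i : Fin 3) | l6 (i : Fin 3) | l7 (i : Fin 3) | l8 (i : Fin 3)
  | l9 (i : Fin 3) | l10 (i : Fin 3) | l11 (i : Fin 3) | l12 (i : Fin 3)

/-- Processes of the protocol. -/
abbrev P := Proc Chan Lab

/-- Secret input `l : c(x).Q`, that is `l : c0.Q[0/x] + l : c1.Q[1/x]`, with the same label in both
branches. -/
def recv (l : Lab) (c : ZMod 2 → Chan) (Q : ZMod 2 → P) : P :=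
  .plus (.pre (Label.plain l) (.inp (c 0)) (Q 0)) (.pre (Label.plain l) (.inp (c 1)) (Q 1))

/-- Output `l : c̄⟨v⟩`. -/
def send (l : Lab) (c : ZMod 2 → Chan) (v : ZMod 2) : P :=
  .pre (Label.plain l) (.out (c v)) .nil

/-- `i == n`: `1` if `i = n` and `0` otherwise. -/
def eqBit (i n : Fin 3) : ZMod 2 := if i = n then 1 else 0

/-- The messages of the master to the three cryptographers when the payer is `i`. -/
def messages (i : Fin 3) : P :=
  .par (.par (send .l2 (Chan.m 0) (eqBit i 0)) (send .l3 (Chan.m 1) (eqBit i 1)))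
    (send .l4 (Chan.m 2) (eqBit i 2))

/-- The nondeterministic choice of the payer. -/
def choice : P :=
  .plus (.plus (.pre (Label.plain (.l12 0)) .tau (messages 0))
    (.pre (Label.plain (.l12 1)) .tau (messages 1)))
    (.pre (Label.plain (.l12 2)) .tau (messages 2))

/-- The master with a protected nondeterministic choice of the payer. -/
def master : P := .protect (Label.plain .l1) choice

/-- Cryptographer `i`; indices are modulo 3. -/
def crypt (i : Fin 3) : P :=
  recv (.l5 i) (Chan.m i) fun pay =>
    recv (.l6 i) (Chan.c i i) fun coin₁ =>
      recv (.l7 i) (Chan.c i (i + 1)) fun coin₂ =>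
        send (.l8 i) (Chan.out i) (pay + coin₁ + coin₂)

/-- Coin `i`, a fair coin that is shown to the cryptographers `i` and `i - 1` (modulo 3). -/
noncomputable def coin (i : Fin 3) : P :=
  .prob (Label.plain (.l9 i)) 2 (PMF.uniformOfFintype (Fin 2))
    ![.par (send (.l10 i) (Chan.c i i) 0) (send (.l11 i) (Chan.c (i - 1) i) 0),
      .par (send (.l10 i) (Chan.c i i) 1) (send (.l11 i) (Chan.c (i - 1) i) 1)]

/-- The channel names for the communication between master and cryptographers. -/
def mChans : List Chan :=
  [Chan.m 0 0, Chan.m 0 1, Chan.m 1 0, Chan.m 1 1, Chan.m 2 0, Chan.m 2 1]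

/-- The channel names for the communication between coins and cryptographers. -/
def cChans : List Chan :=
  [Chan.c 0 0 0, Chan.c 0 0 1, Chan.c 0 1 0, Chan.c 0 1 1,
   Chan.c 1 1 0, Chan.c 1 1 1, Chan.c 1 2 0, Chan.c 1 2 1,
   Chan.c 2 2 0, Chan.c 2 2 1, Chan.c 2 0 0, Chan.c 2 0 1]

/-- The protocol. -/
noncomputable def prot : P :=
  .nus mChans (.par master (.nus cChans
    (.par (.par (.par (crypt 0) (crypt 1)) (crypt 2)) (.par (.par (coin 0) (coin 1)) (coin 2)))))

/-- The independent scheduler `T` selects `i` as the culprit: it resolves the choice of the master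
in favour of `i`. -/
def Selects (T : Sched Lab) (i : Fin 3) : Prop :=
  ∃ T' : Sched Lab, Trans₁ choice T .tau (PMF.pure (messages i, T'))

/-- The announcement of `v` by cryptographer `i`. -/
def announce (x : Fin 3 × ZMod 2) : Act Chan := .out (Chan.out x.1 x.2)

/-- `p_{S,T}(o)`: the probability that the protocol, under the schedulers `S` and `T`, produces the
sequence `o` of announcements. -/
noncomputable def obsProb (S T : Sched Lab) (o : List (Fin 3 × ZMod 2)) : ℝ≥0∞ :=
  traceProb (automaton prot S T) (o.map announce)

end DCP

end CCS

/-! Schedulers see labels, never transmitted bits. Suppose the payer changes from `i` to `j`. The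
message to cryptographer `n` then changes by `f n = eqBit i n + eqBit j n`. Flip coin `n` by `g n`,
where `f n + g n + g (n + 1) = 0` for all `n`; such a `g` exists because `f` sums to zero around the
cycle. Renaming channels accordingly (`flip f g`) carries `messages i` to `messages j`, maps coins
and cryptographers to themselves up to reordering, and leaves every announcement unchanged. A fair
coin is invariant under exchanging its branches, and the two branches of an input carry the same
label, so no scheduler can detect the exchange.

The renaming thus gives a probabilistic bisimulation `StateRel` between the runs under `T₁` and `T₂`
with the same main scheduler. The independent schedulers matter only until the protected choice is
made, where they yield `messages i` and `messages j`. Steps of related states are matched by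
couplings (`StateRel.trans`), and `traceProb_eq_of_bisim` turns this into equality of trace
probabilities.

Full probabilism comes from the invariant `WellLabelled`. Parallel operands have disjoint labels, so
a selection determines who moves. The only ambiguity left is between the two branches of an input;
all inputs are restricted, and in a synchronization the output decides the branch. -/

namespace CCS

/-! ### Injectivity and disjointness of the scheduler operators -/

namespace Sched

variable {L : Type}

/-- Schedulers form a final coalgebra, so `pre` and `sum` are not constructors of an inductive type.
Inverting a transition therefore needs these facts explicitly. -/
theorem pre_inj {h h' : Sel L} {S S' : Sched L} (e : pre h S = pre h' S') : h = h' ∧ S = S' := by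
  have e' := Sigma.mk.inj (PFunctor.M.mk_inj e)
  obtain ⟨e₁, e₂⟩ := e'
  cases e₁
  exact ⟨rfl, congrFun (eq_of_heq e₂) ()⟩

theorem sum_inj {n : ℕ} {S S' : Fin n → Sched L} (e : sum n S = sum n S') : S = S' := by
  have e' := Sigma.mk.inj (PFunctor.M.mk_inj e)
  exact eq_of_heq e'.2

theorem sum_card {n n' : ℕ} {S : Fin n → Sched L} {S' : Fin n' → Sched L}
    (e : sum n S = sum n' S') : n = n' := by
  have e' := Sigma.mk.inj (PFunctor.M.mk_inj e)
  exact SchedShape.sum.inj e'.1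

theorem pre_ne_sum {h : Sel L} {S : Sched L} {n : ℕ} {S' : Fin n → Sched L} :
    pre h S ≠ sum n S' := by
  intro e
  have e' := Sigma.mk.inj (PFunctor.M.mk_inj e)
  cases e'.1

end Sched

/-! ### Scheduler choice: determinism and transfer -/

section Resolve

variable {C L X : Type} {R : Sel L → Sched L → Act C → PMF X → Prop}

theorem Resolve.of_pre {h : Sel L} {S : Sched L} {α : Act C} {μ : PMF X}
    (hr : Resolve R (Sched.pre h S) α μ) : R h S α μ := by
  generalize e : Sched.pre h S = S₀ at hr
  cases hr with
  | pre hR =>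
    obtain ⟨rfl, rfl⟩ := Sched.pre_inj e
    exact hR
  | test i _ _ => exact absurd e Sched.pre_ne_sum

theorem Resolve.of_sum {n : ℕ} {S : Fin n → Sched L} {α : Act C} {μ : PMF X}
    (hr : Resolve R (Sched.sum n S) α μ) :
    ∃ i, Resolve R (S i) α μ ∧
      ∀ j < i, ∀ h S', (S j).Offers h S' → ∀ β ν, ¬ R h S' β ν := by
  generalize e : Sched.sum n S = S₀ at hr
  cases hr with
  | pre hR => exact absurd e.symm Sched.pre_ne_sum
  | test i h₁ h₂ =>
    obtain rfl := Sched.sum_card e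
    obtain rfl := Sched.sum_inj e
    exact ⟨i, h₁, h₂⟩

theorem Resolve.offers {S : Sched L} {α : Act C} {μ : PMF X} (hr : Resolve R S α μ) :
    ∃ h S', S.Offers h S' ∧ R h S' α μ := by
  induction hr with
  | pre hR => exact ⟨_, _, .pre _ _, hR⟩
  | test i _ _ ih =>
    obtain ⟨h, S', ho, hR⟩ := ih
    exact ⟨h, S', .sum i ho, hR⟩

/-- If two different operands of a sum were taken, the later one would require that the earlier
enables nothing, contrary to `Resolve.offers`. -/
theorem Resolve.det
    (hdet : ∀ h S α μ β ν, R h S α μ → R h S β ν → α = β ∧ μ = ν)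
    {S : Sched L} {α β : Act C} {μ ν : PMF X}
    (h₁ : Resolve R S α μ) (h₂ : Resolve R S β ν) : α = β ∧ μ = ν := by
  induction h₁ with
  | pre hR => exact hdet _ _ _ _ _ _ hR h₂.of_pre
  | test i hi hlt ih =>
    obtain ⟨j, hj, hlt'⟩ := h₂.of_sum
    rcases lt_trichotomy i j with hij | rfl | hij
    · obtain ⟨h, S', ho, hR⟩ := hi.offers
      exact absurd hR (hlt' i hij h S' ho _ _)
    · exact ih hj
    · obtain ⟨h, S', ho, hR⟩ := hj.offers
      exact absurd hR (hlt j hij h S' ho _ _)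

/-- The rule for sums has a negative premise, so a simulation alone does not lift to it. Conversely,
only enabledness has to be reflected, which is why `hbwd` does not relate the actions or the
measures. -/
theorem Resolve.transfer {X' : Type} {R' : Sel L → Sched L → Act C → PMF X' → Prop}
    {f : Act C → Act C} {E : PMF X → PMF X' → Prop}
    (hfwd : ∀ h S α μ, R h S α μ → ∃ μ', R' h S (f α) μ' ∧ E μ μ')
    (hbwd : ∀ h S α μ, R' h S α μ → ∃ β ν, R h S β ν)
    {S : Sched L} {α : Act C} {μ : PMF X} (hr : Resolve R S α μ) :
    ∃ μ', Resolve R' S (f α) μ' ∧ E μ μ' := by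
  induction hr with
  | pre hR =>
    obtain ⟨μ', h', hE⟩ := hfwd _ _ _ _ hR
    exact ⟨μ', .pre h', hE⟩
  | test i _ hlt ih =>
    obtain ⟨μ', h', hE⟩ := ih
    refine ⟨μ', .test i h' fun j hj h S' ho β ν hR' => ?_, hE⟩
    obtain ⟨β', ν', hR⟩ := hbwd _ _ _ _ hR'
    exact hlt j hj h S' ho _ _ hR

end Resolve

/-! ## Couplings -/

theorem pmf_pure_inj {X : Type} {x y : X} (h : PMF.pure x = PMF.pure y) : x = y := by
  have hx : x ∈ (PMF.pure y).support := by
    rw [← h, PMF.mem_support_pure_iff]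
  exact (PMF.mem_support_pure_iff _ _).1 hx

/-- `μ` and `ν` are the marginals of a distribution that is supported on `R`. -/
def Coupled {X Y : Type} (R : X → Y → Prop) (μ : PMF X) (ν : PMF Y) : Prop :=
  ∃ ρ : PMF (X × Y), ρ.map Prod.fst = μ ∧ ρ.map Prod.snd = ν ∧ ∀ z ∈ ρ.support, R z.1 z.2

namespace Coupled

variable {X Y X' Y' : Type} {R : X → Y → Prop} {R' : X' → Y' → Prop} {μ : PMF X} {ν : PMF Y}

theorem pure {x : X} {y : Y} (h : R x y) : Coupled R (PMF.pure x) (PMF.pure y) := by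
  refine ⟨PMF.pure (x, y), PMF.pure_map _ _, PMF.pure_map _ _, fun z hz => ?_⟩
  rw [PMF.mem_support_pure_iff] at hz
  subst hz
  exact h

theorem map {f : X → X'} {g : Y → Y'} (h : Coupled R μ ν) (hR : ∀ x y, R x y → R' (f x) (g y)) :
    Coupled R' (μ.map f) (ν.map g) := by
  obtain ⟨ρ, rfl, rfl, hρ⟩ := h
  refine ⟨ρ.map (Prod.map f g), ?_, ?_, fun z hz => ?_⟩
  · rw [PMF.map_comp, PMF.map_comp]; rfl
  · rw [PMF.map_comp, PMF.map_comp]; rfl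
  · rw [PMF.support_map] at hz
    obtain ⟨z', hz', rfl⟩ := hz
    exact hR _ _ (hρ z' hz')

theorem map_same {ι : Type} (p : PMF ι) {f : ι → X} {g : ι → Y} (hR : ∀ i, R (f i) (g i)) :
    Coupled R (p.map f) (p.map g) := by
  refine ⟨p.map fun i => (f i, g i), PMF.map_comp _ _ _, PMF.map_comp _ _ _, fun z hz => ?_⟩
  rw [PMF.support_map] at hz
  obtain ⟨i, _, rfl⟩ := hz
  exact hR i

theorem mono {R₂ : X → Y → Prop} (h : Coupled R μ ν) (hR : ∀ x y, R x y → R₂ x y) :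
    Coupled R₂ μ ν := by
  obtain ⟨ρ, h₁, h₂, hρ⟩ := h
  exact ⟨ρ, h₁, h₂, fun z hz => hR _ _ (hρ z hz)⟩

end Coupled

theorem tsum_map_mul {X Y : Type} (p : PMF X) (f : X → Y) (G : Y → ℝ≥0∞) :
    ∑' y, (p.map f) y * G y = ∑' x, p x * G (f x) := by
  classical
  simp_rw [PMF.map_apply, ← ENNReal.tsum_mul_right]
  rw [ENNReal.tsum_comm]
  refine tsum_congr fun x => ?_
  rw [tsum_eq_single (f x)]
  · simp
  · intro y hy
    simp [hy]

/-- Both sums are expectations under the joint distribution, where the integrands agree. Restricting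
`hG` to the supports lets reachability be used when it is applied. -/
theorem Coupled.tsum_eq {X Y : Type} {R : X → Y → Prop} {μ : PMF X} {ν : PMF Y}
    (h : Coupled R μ ν) {G : X → ℝ≥0∞} {G' : Y → ℝ≥0∞}
    (hG : ∀ x ∈ μ.support, ∀ y ∈ ν.support, R x y → G x = G' y) :
    ∑' x, μ x * G x = ∑' y, ν y * G' y := by
  obtain ⟨ρ, rfl, rfl, hρ⟩ := h
  rw [tsum_map_mul, tsum_map_mul]
  refine tsum_congr fun z => ?_
  by_cases hz : z ∈ ρ.support
  · rw [hG z.1 _ z.2 _ (hρ z hz)]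
    · rw [PMF.support_map]; exact ⟨z, hz, rfl⟩
    · rw [PMF.support_map]; exact ⟨z, hz, rfl⟩
  · rw [PMF.mem_support_iff, not_not] at hz
    simp [hz]

/-! ## Trace probabilities along a bisimulation that renames actions -/

/-- Renaming of the channel of an action. -/
def Act.rename {C : Type} (φ : C → C) : Act C → Act C
  | .inp a => .inp (φ a)
  | .out a => .out (φ a)
  | .tau => .tau

theorem Act.rename_rename {C : Type} {φ : C → C} (hφ : Function.Involutive φ) (α : Act C) :
    (α.rename φ).rename φ = α := by
  cases α <;> simp [Act.rename, hφ _]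

theorem Act.visible_rename {C : Type} (φ : C → C) (α : Act C) :
    (α.rename φ).visible = α.visible.map (Act.rename φ) := by
  cases α <;> rfl

section Trace

variable {Q C : Type}

open Classical in
/-- The total probability of the maximal executions of length `n` from `s` whose visible trace
satisfies `p`. -/
noncomputable def lengthProb (M : ProbAutomaton Q (Act C)) (n : ℕ) (s : Q)
    (p : List (Act C) → Prop) : ℝ≥0∞ :=
  ∑' e : List (Act C × Q),
    if e.length = n ∧ M.Terminal (ProbAutomaton.lastState s e) ∧ p (visibleTrace e)
    then M.execProb s e else 0

/-- Because of `τ` steps the trace does not bound the length of an execution, so executions are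
sorted by length to make induction possible. -/
theorem traceProb_eq_tsum (M : ProbAutomaton Q (Act C)) (w : List (Act C)) :
    traceProb M w = ∑' n, lengthProb M n M.start (· = w) := by
  classical
  unfold traceProb lengthProb
  rw [ENNReal.tsum_comm]
  refine (tsum_subtype {e : List (Act C × Q) | M.Terminal (ProbAutomaton.lastState M.start e) ∧
    visibleTrace e = w} (fun e => M.execProb M.start e)).trans (tsum_congr fun e => ?_)
  rw [tsum_eq_single e.length]
  · simp [Set.indicator_apply]
  · intro n hn
    simp [hn.symm]

theorem lengthProb_zero (M : ProbAutomaton Q (Act C)) (s : Q) (p : List (Act C) → Prop)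
    [Decidable (M.Terminal s ∧ p [])] :
    lengthProb M 0 s p = if M.Terminal s ∧ p [] then 1 else 0 := by
  unfold lengthProb
  rw [tsum_eq_single []]
  · simp [ProbAutomaton.lastState, visibleTrace, ProbAutomaton.execProb]
  · intro e he
    simp [he]

/-- A predicate on traces, in place of a fixed word, lets the first action be absorbed uniformly,
whether or not it is visible. -/
theorem lengthProb_succ (M : ProbAutomaton Q (Act C)) (n : ℕ) (s : Q)
    (p : List (Act C) → Prop) :
    lengthProb M (n + 1) s p =
      ∑' a, ∑' s', M.stepProb s a s' * lengthProb M n s' fun u => p (a.visible ++ u) := by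
  classical
  unfold lengthProb
  have hinj : Function.Injective
      fun z : (Act C × Q) × List (Act C × Q) => z.1 :: z.2 := by
    rintro ⟨x, e⟩ ⟨y, e'⟩ h
    simpa using h
  rw [← hinj.tsum_eq, ENNReal.tsum_prod', ENNReal.tsum_prod']
  · refine tsum_congr fun a => tsum_congr fun s' => ?_
    rw [← ENNReal.tsum_mul_left]
    refine tsum_congr fun e => ?_
    rw [mul_ite, mul_zero]
    have hv : visibleTrace ((a, s') :: e) = a.visible ++ visibleTrace e := rfl
    simp only [List.length_cons, Nat.add_right_cancel_iff, ProbAutomaton.lastState, hv,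
      ProbAutomaton.execProb]
  · intro e he
    cases e with
    | nil => simp at he
    | cons x e => exact ⟨(x, e), rfl⟩

theorem stepProb_of_not_trans {M : ProbAutomaton Q (Act C)} {s : Q} {a : Act C}
    (h : ∀ μ, ¬ M.trans s a μ) (s' : Q) : M.stepProb s a s' = 0 := by
  simp [ProbAutomaton.stepProb, h]

theorem lengthProb_succ_of_trans {M : ProbAutomaton Q (Act C)} {s : Q} {a : Act C} {μ : PMF Q}
    (hdet : ∀ b ν, M.trans s b ν → a = b ∧ μ = ν) (h : M.trans s a μ) (n : ℕ)
    (p : List (Act C) → Prop) :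
    lengthProb M (n + 1) s p =
      ∑' s', μ s' * lengthProb M n s' fun u => p (a.visible ++ u) := by
  rw [lengthProb_succ, tsum_eq_single a]
  · refine tsum_congr fun s' => ?_
    congr 1
    refine le_antisymm (iSup₂_le fun ν hν => ?_) (le_iSup₂_of_le μ h le_rfl)
    rw [(hdet _ _ hν).2]
  · intro b hb
    refine ENNReal.tsum_eq_zero.2 fun s' => ?_
    rw [stepProb_of_not_trans fun ν hν => hb (hdet _ _ hν).1.symm, zero_mul]

theorem lengthProb_succ_of_terminal {M : ProbAutomaton Q (Act C)} {s : Q} (h : M.Terminal s)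
    (n : ℕ) (p : List (Act C) → Prop) : lengthProb M (n + 1) s p = 0 := by
  rw [lengthProb_succ]
  refine ENNReal.tsum_eq_zero.2 fun a => ENNReal.tsum_eq_zero.2 fun s' => ?_
  rw [stepProb_of_not_trans (h a), zero_mul]

variable {M M' : ProbAutomaton Q (Act C)} {φ : C → C} {R : Q → Q → Prop}

/-- Related states are both terminal, or each has exactly one transition and the two are coupled.
Since transitions are unique, the converse direction is needed only for enabledness. -/
theorem lengthProb_eq_of_bisim (hφ : Function.Involutive φ)
    (hM : M.FullyProbabilistic) (hM' : M'.FullyProbabilistic)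
    (hfwd : ∀ s s' α μ, R s s' → M.trans s α μ →
      ∃ μ', M'.trans s' (α.rename φ) μ' ∧ Coupled R μ μ')
    (hbwd : ∀ s s' α μ, R s s' → M'.trans s' α μ → ∃ β ν, M.trans s β ν)
    (n : ℕ) : ∀ (s s' : Q) (p : List (Act C) → Prop), M.Reachable s → M'.Reachable s' → R s s' →
      lengthProb M n s p = lengthProb M' n s' fun u => p (u.map (Act.rename φ)) := by
  classical
  have hterm : ∀ s s', R s s' → (M.Terminal s ↔ M'.Terminal s') := by
    intro s s' hR
    constructor
    · intro h α μ hμ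
      obtain ⟨β, ν, hν⟩ := hbwd _ _ _ _ hR hμ
      exact h _ _ hν
    · intro h α μ hμ
      obtain ⟨μ', hμ', _⟩ := hfwd _ _ _ _ hR hμ
      exact h _ _ hμ'
  induction n with
  | zero =>
    intro s s' p _ _ hR
    rw [lengthProb_zero, lengthProb_zero]
    simp [hterm s s' hR]
  | succ n ih =>
    intro s s' p hs hs' hR
    by_cases ht : M.Terminal s
    · rw [lengthProb_succ_of_terminal ht, lengthProb_succ_of_terminal ((hterm s s' hR).1 ht)]
    · simp only [ProbAutomaton.Terminal, not_forall, not_not] at ht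
      obtain ⟨α, μ, hμ⟩ := ht
      obtain ⟨μ', hμ', hc⟩ := hfwd _ _ _ _ hR hμ
      rw [lengthProb_succ_of_trans (fun b ν => hM s hs _ _ _ _ hμ) hμ,
        lengthProb_succ_of_trans (fun b ν => hM' s' hs' _ _ _ _ hμ') hμ']
      refine hc.tsum_eq fun x hx y hy hxy => ?_
      rw [ih x y _ (hs.step hμ hx) (hs'.step hμ' hy) hxy]
      congr 1
      funext u
      rw [List.map_append, ← Act.visible_rename, Act.rename_rename hφ]

theorem traceProb_eq_of_bisim (hφ : Function.Involutive φ)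
    (hM : M.FullyProbabilistic) (hM' : M'.FullyProbabilistic)
    (hfwd : ∀ s s' α μ, R s s' → M.trans s α μ →
      ∃ μ', M'.trans s' (α.rename φ) μ' ∧ Coupled R μ μ')
    (hbwd : ∀ s s' α μ, R s s' → M'.trans s' α μ → ∃ β ν, M.trans s β ν)
    (hstart : R M.start M'.start) {w : List (Act C)} (hw : w.map (Act.rename φ) = w) :
    traceProb M w = traceProb M' w := by
  rw [traceProb_eq_tsum, traceProb_eq_tsum]
  refine tsum_congr fun n => ?_
  rw [lengthProb_eq_of_bisim hφ hM hM' hfwd hbwd n _ _ _ .start .start hstart]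
  congr 1
  funext u
  have hinv : Function.Involutive (List.map (Act.rename φ)) := fun v => by
    simp [Function.comp_def, Act.rename_rename hφ]
  refine propext ⟨fun h => ?_, fun h => ?_⟩
  · rw [← hinv u, h, hw]
  · rw [h, hw]

end Trace

namespace DCP

/-- Complete processes are considered with a main and an independent scheduler. -/
abbrev Scheds := Sched Lab × Sched Lab

/-! ## The choice of the payer -/

theorem step_choice {K : Type} {I : P → K → Act Chan → PMF (P × K) → Prop} {h : Sel Lab} {k : K}
    {α : Act Chan} {μ : PMF (P × K)} (hs : Step I choice h k α μ) :
    ∃ i, h = .one (Label.plain (.l12 i)) ∧ α = .tau ∧ μ = PMF.pure (messages i, k) := by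
  unfold choice at hs
  cases hs with
  | sum1 _ hs =>
    cases hs with
    | sum1 _ hs => cases hs; exact ⟨0, rfl, rfl, rfl⟩
    | sum2 _ hs => cases hs; exact ⟨1, rfl, rfl, rfl⟩
  | sum2 _ hs => cases hs; exact ⟨2, rfl, rfl, rfl⟩

theorem trans_choice_det {T : Sched Lab} {α β : Act Chan} {μ ν : PMF (P × Sched Lab)}
    (h₁ : Trans₁ choice T α μ) (h₂ : Trans₁ choice T β ν) : α = β ∧ μ = ν := by
  refine Resolve.det (fun h S α μ β ν h₁ h₂ => ?_) h₁ h₂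
  obtain ⟨i, rfl, rfl, rfl⟩ := step_choice h₁
  obtain ⟨j, hj, rfl, rfl⟩ := step_choice h₂
  obtain rfl : i = j := by simpa [Label.plain] using hj
  exact ⟨rfl, rfl⟩

theorem trans_choice {T : Sched Lab} {α : Act Chan} {μ : PMF (P × Sched Lab)}
    (h : Trans₁ choice T α μ) : α = .tau ∧ ∃ i T', μ = PMF.pure (messages i, T') := by
  obtain ⟨_, T', _, hs⟩ := Resolve.offers h
  obtain ⟨i, _, hα, hμ⟩ := step_choice hs
  exact ⟨hα, i, T', hμ⟩

/-- This is the only place where the independent scheduler acts; the main continuation `k.1` passes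
through unchanged. -/
theorem step_master {h : Sel Lab} {k : Scheds} {α : Act Chan} {μ : PMF (P × Scheds)}
    (hs : Step Indep master h k α μ) :
    h = .one (Label.plain .l1) ∧ α = .tau ∧ ∃ i T', μ = PMF.pure (messages i, k.1, T') ∧
      Trans₁ choice k.2 .tau (PMF.pure (messages i, T')) := by
  unfold master at hs
  cases hs with
  | indep hI =>
    cases hI with
    | mk hT =>
      obtain ⟨rfl, i, T', rfl⟩ := trans_choice hT
      exact ⟨rfl, rfl, i, T', PMF.pure_map _ _, hT⟩

/-! ## Well-labelled processes -/

/-- The processes that occur in the protocol: operands of parallel compositions have different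
labels, `A` contains the atomic labels and `B` the free input channels. -/
inductive WellLabelled : Set Lab → Set Chan → P → Prop
  | nil {A : Set Lab} {B : Set Chan} : WellLabelled A B .nil
  | pre {A : Set Lab} {B : Set Chan} {l : Label Lab} {α : Act Chan} {Q : P} :
      l.atom ∈ A → (∀ a, α = .inp a → a ∈ B) → WellLabelled A B Q → WellLabelled A B (.pre l α Q)
  | recv {A : Set Lab} {B : Set Chan} {l : Label Lab} {a b : Chan} {Q Q' : P} :
      l.atom ∈ A → a ∈ B → b ∈ B → a ≠ b → WellLabelled A B Q → WellLabelled A B Q' →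
      WellLabelled A B (.plus (.pre l (.inp a) Q) (.pre l (.inp b) Q'))
  | par {A A₁ A₂ : Set Lab} {B : Set Chan} {Q Q' : P} :
      Disjoint A₁ A₂ → A₁ ⊆ A → A₂ ⊆ A → WellLabelled A₁ B Q → WellLabelled A₂ B Q' →
      WellLabelled A B (.par Q Q')
  | prob {A : Set Lab} {B : Set Chan} {l : Label Lab} {n : ℕ} {p : PMF (Fin n)} {Q : Fin n → P} :
      l.atom ∈ A → (∀ i, WellLabelled A B (Q i)) → WellLabelled A B (.prob l n p Q)
  | nu {A : Set Lab} {B : Set Chan} {a : Chan} {Q : P} :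
      WellLabelled A (insert a B) Q → WellLabelled A B (.nu a Q)
  | master {A : Set Lab} {B : Set Chan} :
      Lab.l1 ∈ A → (∀ i, WellLabelled A B (messages i)) → WellLabelled A B master

/-- All the labels of a selection have atoms in `A`. -/
def SelIn (A : Set Lab) : Sel Lab → Prop
  | .one l => l.atom ∈ A
  | .sync l₁ l₂ => l₁.atom ∈ A ∧ l₂.atom ∈ A

theorem SelIn.mono {A A' : Set Lab} (hA : A ⊆ A') {h : Sel Lab} (hs : SelIn A h) :
    SelIn A' h := by
  cases h with
  | one l => exact hA hs
  | sync l₁ l₂ => exact ⟨hA hs.1, hA hs.2⟩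

theorem SelIn.not_disjoint {A A' : Set Lab} (hA : Disjoint A A') {h : Sel Lab} (hs : SelIn A h)
    (hs' : SelIn A' h) : False := by
  cases h with
  | one l => exact Set.disjoint_left.1 hA hs hs'
  | sync l₁ l₂ => exact Set.disjoint_left.1 hA hs.1 hs'.1

namespace WellLabelled

variable {A : Set Lab} {B : Set Chan} {Q : P} {h : Sel Lab} {k : Scheds} {α : Act Chan}
  {μ : PMF (P × Scheds)}

theorem selIn (hQ : WellLabelled A B Q) (hs : Step Indep Q h k α μ) : SelIn A h := by
  induction hQ generalizing h k α μ with
  | nil => cases hs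
  | pre hl _ _ _ => cases hs; exact hl
  | recv hl _ _ _ _ _ _ _ =>
    cases hs with
    | sum1 _ hs => cases hs; exact hl
    | sum2 _ hs => cases hs; exact hl
  | par _ h₁ h₂ _ _ ih₁ ih₂ =>
    cases hs with
    | par1 _ hs => exact (ih₁ hs).mono h₁
    | par2 _ hs => exact (ih₂ hs).mono h₂
    | com1 hi ho => exact ⟨h₁ (ih₁ hi), h₂ (ih₂ ho)⟩
    | com2 hi ho => exact ⟨h₂ (ih₂ hi), h₁ (ih₁ ho)⟩
  | prob hl _ _ => cases hs; exact hl
  | nu _ ih =>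
    cases hs with
    | res _ hs _ _ => exact ih hs
  | master hl _ _ => rw [(step_master hs).1]; exact hl

/-- For `B = ∅` this excludes the one kind of nondeterminism that `det` leaves open. -/
theorem inp_mem (hQ : WellLabelled A B Q) {a : Chan} (hs : Step Indep Q h k (.inp a) μ) :
    a ∈ B := by
  induction hQ generalizing h k μ with
  | nil => cases hs
  | pre _ ha _ _ => cases hs; exact ha _ rfl
  | recv _ ha hb _ _ _ _ _ =>
    cases hs with
    | sum1 _ hs => cases hs; exact ha
    | sum2 _ hs => cases hs; exact hb
  | par _ _ _ _ _ ih₁ ih₂ =>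
    cases hs with
    | par1 _ hs => exact ih₁ hs
    | par2 _ hs => exact ih₂ hs
  | prob _ _ _ => cases hs
  | nu _ ih =>
    cases hs with
    | res _ hs ha _ => exact (ih hs).resolve_left fun e => ha (by rw [e])
  | master _ _ _ => exact absurd (step_master hs).2.1 (by simp)

/-- Only the coins randomize and only the master changes a scheduler, and both do so by `τ`. -/
theorem eq_pure (hQ : WellLabelled A B Q) (hs : Step Indep Q h k α μ) (hα : α ≠ .tau) :
    ∃ Q', μ = PMF.pure (Q', k) := by
  induction hQ generalizing h k μ with
  | nil => cases hs
  | pre _ _ _ _ => cases hs; exact ⟨_, rfl⟩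
  | recv _ _ _ _ _ _ _ _ =>
    cases hs with
    | sum1 _ hs => cases hs; exact ⟨_, rfl⟩
    | sum2 _ hs => cases hs; exact ⟨_, rfl⟩
  | par _ _ _ _ _ ih₁ ih₂ =>
    cases hs with
    | par1 _ hs => obtain ⟨Q', rfl⟩ := ih₁ hs; exact ⟨_, PMF.pure_map _ _⟩
    | par2 _ hs => obtain ⟨Q', rfl⟩ := ih₂ hs; exact ⟨_, PMF.pure_map _ _⟩
    | com1 _ _ => exact absurd rfl hα
    | com2 _ _ => exact absurd rfl hα
  | prob _ _ _ => cases hs; exact absurd rfl hα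
  | nu _ ih =>
    cases hs with
    | res _ hs _ _ => obtain ⟨Q', rfl⟩ := ih hs; exact ⟨_, PMF.pure_map _ _⟩
  | master _ _ _ => exact absurd (step_master hs).2.1 hα

theorem sched_eq (hQ : WellLabelled A B Q) {Q' : P} {k' : Scheds}
    (hs : Step Indep Q h k α (PMF.pure (Q', k'))) (hα : α ≠ .tau) : k' = k := by
  obtain ⟨Q'', e⟩ := hQ.eq_pure hs hα
  exact (Prod.mk.inj (pmf_pure_inj e)).2

theorem preserved (hQ : WellLabelled A B Q) (hs : Step Indep Q h k α μ) :
    ∀ x ∈ μ.support, WellLabelled A B x.1 := by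
  induction hQ generalizing h k α μ with
  | nil => cases hs
  | pre _ _ hQ _ =>
    cases hs
    intro x hx
    rw [PMF.mem_support_pure_iff] at hx
    subst hx
    exact hQ
  | recv _ _ _ _ hQ hQ' _ _ =>
    intro x hx
    cases hs with
    | sum1 _ hs =>
      cases hs
      rw [PMF.mem_support_pure_iff] at hx
      subst hx
      exact hQ
    | sum2 _ hs =>
      cases hs
      rw [PMF.mem_support_pure_iff] at hx
      subst hx
      exact hQ'
  | par hd h₁ h₂ hQ hQ' ih₁ ih₂ =>
    intro x hx
    cases hs with
    | par1 _ hs =>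
      rw [PMF.support_map] at hx
      obtain ⟨y, hy, rfl⟩ := hx
      exact .par hd h₁ h₂ (ih₁ hs y hy) hQ'
    | par2 _ hs =>
      rw [PMF.support_map] at hx
      obtain ⟨y, hy, rfl⟩ := hx
      exact .par hd h₁ h₂ hQ (ih₂ hs y hy)
    | com1 hi ho =>
      rw [PMF.mem_support_pure_iff] at hx
      subst hx
      exact .par hd h₁ h₂ (ih₁ hi _ ((PMF.mem_support_pure_iff _ _).2 rfl))
        (ih₂ ho _ ((PMF.mem_support_pure_iff _ _).2 rfl))
    | com2 hi ho =>
      rw [PMF.mem_support_pure_iff] at hx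
      subst hx
      exact .par hd h₁ h₂ (ih₁ ho _ ((PMF.mem_support_pure_iff _ _).2 rfl))
        (ih₂ hi _ ((PMF.mem_support_pure_iff _ _).2 rfl))
  | prob _ hQ _ =>
    cases hs
    intro x hx
    rw [PMF.support_map] at hx
    obtain ⟨i, _, rfl⟩ := hx
    exact hQ i
  | nu _ ih =>
    intro x hx
    cases hs with
    | res _ hs _ _ =>
      rw [PMF.support_map] at hx
      obtain ⟨y, hy, rfl⟩ := hx
      exact .nu (ih hs y hy)
  | master _ hQ _ =>
    intro x hx
    obtain ⟨_, _, i, T', rfl, _⟩ := step_master hs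
    rw [PMF.mem_support_pure_iff] at hx
    subst hx
    exact hQ i

/-- Two transitions under the same schedulers are equal, or they are inputs on different
channels. -/
theorem det (hQ : WellLabelled A B Q) {β : Act Chan} {ν : PMF (P × Scheds)}
    (hs : Step Indep Q h k α μ) (hs' : Step Indep Q h k β ν) :
    (α = β ∧ μ = ν) ∨ ∃ a b, a ≠ b ∧ α = .inp a ∧ β = .inp b := by
  induction hQ generalizing h k α β μ ν with
  | nil => cases hs
  | pre _ _ _ _ => cases hs; cases hs'; exact .inl ⟨rfl, rfl⟩
  | recv _ _ _ hab _ _ _ _ =>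
    cases hs with
    | sum1 _ hs =>
      cases hs
      cases hs' with
      | sum1 _ hs' => cases hs'; exact .inl ⟨rfl, rfl⟩
      | sum2 _ hs' => cases hs'; exact .inr ⟨_, _, hab, rfl, rfl⟩
    | sum2 _ hs =>
      cases hs
      cases hs' with
      | sum1 _ hs' => cases hs'; exact .inr ⟨_, _, hab.symm, rfl, rfl⟩
      | sum2 _ hs' => cases hs'; exact .inl ⟨rfl, rfl⟩
  | @par A A₁ A₂ B Q Q' hd h₁ h₂ hQ hQ' ih₁ ih₂ =>
    -- The partner that outputs is deterministic, so it fixes the common channel, and this selects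
    -- one branch of the input. By `sched_eq` the intermediate schedulers are those at the start, so
    -- the two outputs are compared under the same ones. The statement is general in `R` and `R'` to
    -- serve both directions of communication.
    have hsync : ∀ {R R' : P} {A₁ A₂ : Set Lab} {l₁ l₂ : Label Lab} {a b : Chan} {k : Scheds}
        {x y x' y' : P × Scheds}, WellLabelled A₁ B R → WellLabelled A₂ B R' →
        (∀ {h : Sel Lab} {k : Scheds} {α : Act Chan} {μ : PMF (P × Scheds)} {β : Act Chan}
          {ν : PMF (P × Scheds)}, Step Indep R h k α μ → Step Indep R h k β ν →
          (α = β ∧ μ = ν) ∨ ∃ a b, a ≠ b ∧ α = .inp a ∧ β = .inp b) →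
        (∀ {h : Sel Lab} {k : Scheds} {α : Act Chan} {μ : PMF (P × Scheds)} {β : Act Chan}
          {ν : PMF (P × Scheds)}, Step Indep R' h k α μ → Step Indep R' h k β ν →
          (α = β ∧ μ = ν) ∨ ∃ a b, a ≠ b ∧ α = .inp a ∧ β = .inp b) →
        Step Indep R (.one l₁) k (.inp a) (PMF.pure x) →
        Step Indep R' (.one l₂) x.2 (.out a) (PMF.pure y) →
        Step Indep R (.one l₁) k (.inp b) (PMF.pure x') →
        Step Indep R' (.one l₂) x'.2 (.out b) (PMF.pure y') → x = x' ∧ y = y' := by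
      rintro R R' A₁ A₂ l₁ l₂ a b k ⟨x, kx⟩ y ⟨x', kx'⟩ y' hR hR' ih ih' hi ho hi' ho'
      obtain rfl := hR.sched_eq hi (by simp)
      obtain rfl := hR.sched_eq hi' (by simp)
      rcases ih' ho ho' with ⟨e, e'⟩ | ⟨_, _, _, e, _⟩
      · obtain rfl := Act.out.inj e
        rcases ih hi hi' with ⟨_, e''⟩ | ⟨_, _, hne, e₁, e₂⟩
        · exact ⟨pmf_pure_inj e'', pmf_pure_inj e'⟩
        · exact absurd ((Act.inp.inj e₁).symm.trans (Act.inp.inj e₂)) hne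
      · cases e
    cases hs with
    | par1 _ hs =>
      have hA := hQ.selIn hs
      cases hs' with
      | par1 _ hs' =>
        rcases ih₁ hs hs' with ⟨rfl, rfl⟩ | e
        · exact .inl ⟨rfl, rfl⟩
        · exact .inr e
      | par2 _ hs' => exact (SelIn.not_disjoint hd hA (hQ'.selIn hs')).elim
      | com1 hi ho => exact (Set.disjoint_left.1 hd hA.2 (hQ'.selIn ho)).elim
      | com2 hi ho => exact (Set.disjoint_left.1 hd hA.1 (hQ'.selIn hi)).elim
    | par2 _ hs =>
      have hA := hQ'.selIn hs
      cases hs' with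
      | par1 _ hs' => exact (SelIn.not_disjoint hd (hQ.selIn hs') hA).elim
      | par2 _ hs' =>
        rcases ih₂ hs hs' with ⟨rfl, rfl⟩ | e
        · exact .inl ⟨rfl, rfl⟩
        · exact .inr e
      | com1 hi ho => exact (Set.disjoint_left.1 hd (hQ.selIn hi) hA.1).elim
      | com2 hi ho => exact (Set.disjoint_left.1 hd (hQ.selIn ho) hA.2).elim
    | com1 hi ho =>
      cases hs' with
      | par1 _ hs' => exact (Set.disjoint_left.1 hd (hQ.selIn hs').2 (hQ'.selIn ho)).elim
      | par2 _ hs' => exact (Set.disjoint_left.1 hd (hQ.selIn hi) (hQ'.selIn hs').1).elim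
      | com1 hi' ho' =>
        obtain ⟨e, e'⟩ := hsync hQ hQ' ih₁ ih₂ hi ho hi' ho'
        cases e
        cases e'
        exact .inl ⟨rfl, rfl⟩
      | com2 hi' ho' => exact (Set.disjoint_left.1 hd (hQ.selIn hi) (hQ'.selIn hi')).elim
    | com2 hi ho =>
      cases hs' with
      | par1 _ hs' => exact (Set.disjoint_left.1 hd (hQ.selIn hs').1 (hQ'.selIn hi)).elim
      | par2 _ hs' => exact (Set.disjoint_left.1 hd (hQ.selIn ho) (hQ'.selIn hs').2).elim
      | com1 hi' ho' => exact (Set.disjoint_left.1 hd (hQ.selIn hi') (hQ'.selIn hi)).elim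
      | com2 hi' ho' =>
        obtain ⟨e, e'⟩ := hsync hQ' hQ ih₂ ih₁ hi ho hi' ho'
        cases e
        cases e'
        exact .inl ⟨rfl, rfl⟩
  | prob _ _ _ => cases hs; cases hs'; exact .inl ⟨rfl, rfl⟩
  | nu _ ih =>
    cases hs with
    | res _ hs _ _ =>
      cases hs' with
      | res _ hs' _ _ =>
        rcases ih hs hs' with ⟨rfl, rfl⟩ | e
        · exact .inl ⟨rfl, rfl⟩
        · exact .inr e
  | master _ _ _ =>
    obtain ⟨_, rfl, i, T', rfl, hT⟩ := step_master hs
    obtain ⟨_, rfl, j, T'', rfl, hT'⟩ := step_master hs'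
    have e := pmf_pure_inj (trans_choice_det hT hT').2
    rw [Prod.mk.injEq] at e
    rw [e.1, e.2]
    exact .inl ⟨rfl, rfl⟩

theorem fullyProbabilistic (hQ : WellLabelled A ∅ Q) (S T : Sched Lab) :
    (automaton Q S T).FullyProbabilistic := by
  have hinv : ∀ s, (automaton Q S T).Reachable s → WellLabelled A ∅ s.1 := by
    intro s hs
    induction hs with
    | start => exact hQ
    | step _ ht hx ih =>
      obtain ⟨_, _, _, hs⟩ := Resolve.offers ht
      exact ih.preserved hs _ hx
  intro s hs α μ β ν hα hβ
  refine Resolve.det (fun h S' α μ β ν h₁ h₂ => ?_) hα hβ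
  rcases (hinv s hs).det h₁ h₂ with e | ⟨a, _, _, rfl, _⟩
  · exact e
  · exact ((hinv s hs).inp_mem h₁).elim

theorem nus {as : List Chan} (hQ : WellLabelled A (B ∪ {a | a ∈ as}) Q) :
    WellLabelled A B (Proc.nus as Q) := by
  induction as generalizing B with
  | nil => simpa [Proc.nus] using hQ
  | cons a as ih =>
    refine .nu (ih ?_)
    convert hQ using 1
    ext b
    simp [or_left_comm, or_assoc]

end WellLabelled

theorem wellLabelled_recv {A : Set Lab} {B : Set Chan} {l : Lab} {c : ZMod 2 → Chan}
    {Q : ZMod 2 → P} (hl : l ∈ A) (hc : ∀ v, c v ∈ B) (hne : c 0 ≠ c 1)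
    (hQ : ∀ v, WellLabelled A B (Q v)) : WellLabelled A B (recv l c Q) :=
  .recv hl (hc 0) (hc 1) hne (hQ 0) (hQ 1)

theorem wellLabelled_send {A : Set Lab} {B : Set Chan} {l : Lab} {c : ZMod 2 → Chan}
    {v : ZMod 2} (hl : l ∈ A) : WellLabelled A B (send l c v) :=
  .pre hl (by simp) .nil

theorem wellLabelled_crypt {B : Set Chan} (i : Fin 3) (hm : ∀ v, Chan.m i v ∈ B)
    (hc : ∀ v, Chan.c i i v ∈ B) (hc' : ∀ v, Chan.c i (i + 1) v ∈ B) :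
    WellLabelled {.l5 i, .l6 i, .l7 i, .l8 i} B (crypt i) :=
  wellLabelled_recv (by simp) hm (by simp) fun _ =>
    wellLabelled_recv (by simp) hc (by simp) fun _ =>
      wellLabelled_recv (by simp) hc' (by simp) fun _ => wellLabelled_send (by simp)

theorem wellLabelled_coin {B : Set Chan} (i : Fin 3) :
    WellLabelled {.l9 i, .l10 i, .l11 i} B (coin i) := by
  have h : ∀ v, WellLabelled {.l9 i, .l10 i, .l11 i} B
      (.par (send (.l10 i) (Chan.c i i) v) (send (.l11 i) (Chan.c (i - 1) i) v)) := fun v =>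
    .par (A₁ := {.l10 i}) (A₂ := {.l11 i}) (by simp) (by simp) (by simp)
      (wellLabelled_send (by simp)) (wellLabelled_send (by simp))
  refine .prob (by simp [Label.plain]) fun b => ?_
  fin_cases b
  · exact h 0
  · exact h 1

theorem wellLabelled_messages {A : Set Lab} {B : Set Chan} (h₂ : .l2 ∈ A) (h₃ : .l3 ∈ A)
    (h₄ : .l4 ∈ A) (i : Fin 3) : WellLabelled A B (messages i) :=
  .par (A₁ := {.l2, .l3}) (A₂ := {.l4}) (by simp) (by simp [Set.insert_subset_iff, *]) (by simpa)
    (.par (A₁ := {.l2}) (A₂ := {.l3}) (by simp) (by simp) (by simp)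
      (wellLabelled_send (by simp)) (wellLabelled_send (by simp)))
    (wellLabelled_send (by simp))

theorem mem_mChans {a : Chan} : a ∈ mChans ↔ ∃ i v, a = .m i v := by
  constructor
  · simp only [mChans, List.mem_cons, List.not_mem_nil, or_false]
    rintro (rfl | rfl | rfl | rfl | rfl | rfl) <;> exact ⟨_, _, rfl⟩
  · rintro ⟨i, v, rfl⟩
    revert i v
    simp only [mChans, List.mem_cons, List.not_mem_nil, or_false, Chan.m.injEq]
    decide

theorem mem_cChans {a : Chan} :
    a ∈ cChans ↔ ∃ i v, a = .c i i v ∨ a = .c i (i + 1) v := by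
  constructor
  · simp only [cChans, List.mem_cons, List.not_mem_nil, or_false]
    rintro (rfl | rfl | rfl | rfl | rfl | rfl | rfl | rfl | rfl | rfl | rfl | rfl) <;>
      simp only [Chan.c.injEq] <;> decide
  · rintro ⟨i, v, rfl | rfl⟩ <;> revert i v <;>
      simp only [cChans, List.mem_cons, List.not_mem_nil, or_false, Chan.c.injEq] <;> decide

theorem wellLabelled_prot : WellLabelled Set.univ ∅ prot := by
  -- The labels `l12 i` are absent: they occur only inside the protected choice, which the main
  -- scheduler cannot address.
  refine .nus (.par (A₁ := {.l1, .l2, .l3, .l4})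
    (A₂ := {l | ∃ i, l ∈ ({.l5 i, .l6 i, .l7 i, .l8 i, .l9 i, .l10 i, .l11 i} : Set Lab)})
    ?_ (Set.subset_univ _) (Set.subset_univ _) (.master (by simp) ?_) (.nus ?_))
  · simp [Set.disjoint_left]
  · exact wellLabelled_messages (by simp) (by simp) (by simp)
  · have hcrypt : ∀ i, WellLabelled {.l5 i, .l6 i, .l7 i, .l8 i}
        ((∅ ∪ {a | a ∈ mChans}) ∪ {a | a ∈ cChans}) (crypt i) := fun i =>
      wellLabelled_crypt i (fun v => .inl (.inr (mem_mChans.2 ⟨i, v, rfl⟩)))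
        (fun v => .inr (mem_cChans.2 ⟨i, v, .inl rfl⟩))
        (fun v => .inr (mem_cChans.2 ⟨i, v, .inr rfl⟩))
    -- Parallel compositions associate to the left, so in each group the operands 0 and 1 together
    -- receive the labels with index different from 2.
    refine .par (A₁ := {l | ∃ i, l ∈ ({.l5 i, .l6 i, .l7 i, .l8 i} : Set Lab)})
      (A₂ := {l | ∃ i, l ∈ ({.l9 i, .l10 i, .l11 i} : Set Lab)}) ?_ ?_ ?_
      (.par (A₁ := {l | ∃ i ≠ 2, l ∈ ({.l5 i, .l6 i, .l7 i, .l8 i} : Set Lab)}) ?_ ?_ ?_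
        (.par ?_ ?_ ?_ (hcrypt 0) (hcrypt 1)) (hcrypt 2))
      (.par (A₁ := {l | ∃ i ≠ 2, l ∈ ({.l9 i, .l10 i, .l11 i} : Set Lab)}) ?_ ?_ ?_
        (.par ?_ ?_ ?_ (wellLabelled_coin 0) (wellLabelled_coin 1)) (wellLabelled_coin 2))
    all_goals
      first
      | rw [Set.disjoint_left]
        rintro l hl hl'
        simp only [Set.mem_ofPred_eq, Set.mem_insert_iff, Set.mem_singleton_iff] at hl hl'
        grind
      | intro l hl
        simp only [Set.mem_ofPred_eq, Set.mem_insert_iff, Set.mem_singleton_iff] at hl ⊢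
        grind

/-! ## Renaming channels -/

/-- A renaming permutes the names within a block of restrictions and need not respect their order,
so a block is treated as a whole. -/
theorem step_nus {K : Type} {I : P → K → Act Chan → PMF (P × K) → Prop} {as : List Chan} {Q : P}
    {h : Sel Lab} {k : K} {α : Act Chan} {μ : PMF (P × K)} :
    Step I (Proc.nus as Q) h k α μ ↔
      (∃ μ', Step I Q h k α μ' ∧ μ = μ'.map fun x => (Proc.nus as x.1, x.2)) ∧
        ∀ a ∈ as, α ≠ .inp a ∧ α ≠ .out a := by
  induction as generalizing μ with
  | nil =>
    have hid : ∀ μ' : PMF (P × K), (μ'.map fun x => (x.1, x.2)) = μ' := PMF.map_id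
    simp [Proc.nus, hid]
  | cons a as ih =>
    constructor
    · intro hs
      cases hs with
      | res _ hs hi ho =>
        obtain ⟨⟨μ', hμ', rfl⟩, has⟩ := ih.1 hs
        refine ⟨⟨μ', hμ', PMF.map_comp _ _ _⟩, ?_⟩
        simpa using ⟨⟨hi, ho⟩, has⟩
    · rintro ⟨⟨μ', hμ', rfl⟩, has⟩
      rw [List.forall_mem_cons] at has
      have := Step.res a (ih.2 ⟨⟨μ', hμ', rfl⟩, has.2⟩) has.1.1 has.1.2
      rwa [PMF.map_comp] at this

theorem act_rename_restricted {φ : Chan → Chan} (hφ : Function.Involutive φ)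
    {as as' : List Chan} (has : ∀ a, a ∈ as ↔ φ a ∈ as') {α : Act Chan}
    (hα : ∀ a ∈ as, α ≠ .inp a ∧ α ≠ .out a) :
    ∀ a ∈ as', α.rename φ ≠ .inp a ∧ α.rename φ ≠ .out a := by
  intro a ha
  have ha' : φ a ∈ as := (has _).2 (by rwa [hφ a])
  constructor
  · intro e
    apply (hα _ ha').1
    rw [← Act.rename_rename hφ α, e]; rfl
  · intro e
    apply (hα _ ha').2
    rw [← Act.rename_rename hφ α, e]; rfl

/-- `Renamed φ Q Q'`: up to the order of the operands of sums, of the branches of probabilistic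
choices and of restrictions, `Q'` arises from `Q` by renaming the channels according to `φ`. -/
inductive Renamed (φ : Chan → Chan) : P → P → Prop
  | nil : Renamed φ .nil .nil
  | pre (l : Label Lab) (α : Act Chan) {Q Q' : P} :
      Renamed φ Q Q' → Renamed φ (.pre l α Q) (.pre l (α.rename φ) Q')
  | plus {Q Q' R R' : P} :
      Renamed φ Q Q' → Renamed φ R R' → Renamed φ (.plus Q R) (.plus Q' R')
  | plus_swap {Q Q' R R' : P} :
      Renamed φ Q Q' → Renamed φ R R' → Renamed φ (.plus Q R) (.plus R' Q')
  | par {Q Q' R R' : P} :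
      Renamed φ Q Q' → Renamed φ R R' → Renamed φ (.par Q R) (.par Q' R')
  | prob (l : Label Lab) {n : ℕ} {p p' : PMF (Fin n)} {Q Q' : Fin n → P}
      (e : Equiv.Perm (Fin n)) :
      p.map e = p' → (∀ i, Renamed φ (Q i) (Q' (e i))) →
      Renamed φ (.prob l n p Q) (.prob l n p' Q')
  | nus {as as' : List Chan} {Q Q' : P} :
      (∀ a, a ∈ as ↔ φ a ∈ as') → Renamed φ Q Q' →
      Renamed φ (Proc.nus as Q) (Proc.nus as' Q')

namespace Renamed

variable {φ : Chan → Chan} {Q Q' : P}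

theorem symm (hφ : Function.Involutive φ) (hQ : Renamed φ Q Q') : Renamed φ Q' Q := by
  induction hQ with
  | nil => exact .nil
  | pre l α _ ih =>
    have := Renamed.pre (φ := φ) l (α.rename φ) ih
    rwa [Act.rename_rename hφ] at this
  | plus _ _ ih₁ ih₂ => exact .plus ih₁ ih₂
  | plus_swap _ _ ih₁ ih₂ => exact .plus_swap ih₂ ih₁
  | par _ _ ih₁ ih₂ => exact .par ih₁ ih₂
  | prob l e hp _ ih =>
    refine .prob l e.symm ?_ fun i => ?_
    · rw [← hp, PMF.map_comp, e.symm_comp_self, PMF.map_id]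
    · simpa using ih (e.symm i)
  | nus has _ ih => exact .nus (fun a => by rw [has, hφ a]) ih

variable {K : Type} {I : P → K → Act Chan → PMF (P × K) → Prop} {h : Sel Lab} {k : K}
  {α : Act Chan} {μ : PMF (P × K)}

/-- `Renamed` admits no protected process, so nothing inspects `k` and the matching step exists for
every `k'`. This freedom is what the intermediate scheduler in the communication rules calls for. -/
theorem step_visible (hφ : Function.Involutive φ) (hQ : Renamed φ Q Q') (hs : Step I Q h k α μ)
    (hα : α ≠ .tau) : ∃ R R', Renamed φ R R' ∧ μ = PMF.pure (R, k) ∧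
      ∀ k', Step I Q' h k' (α.rename φ) (PMF.pure (R', k')) := by
  induction hQ generalizing h k μ with
  | nil => cases hs
  | pre l β hQ _ => cases hs; exact ⟨_, _, hQ, rfl, fun k' => .act _ _ _ _⟩
  | plus _ _ ih₁ ih₂ =>
    cases hs with
    | sum1 _ hs =>
      obtain ⟨R, R', hR, rfl, hs'⟩ := ih₁ hs
      exact ⟨R, R', hR, rfl, fun k' => .sum1 _ (hs' k')⟩
    | sum2 _ hs =>
      obtain ⟨R, R', hR, rfl, hs'⟩ := ih₂ hs
      exact ⟨R, R', hR, rfl, fun k' => .sum2 _ (hs' k')⟩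
  | plus_swap _ _ ih₁ ih₂ =>
    cases hs with
    | sum1 _ hs =>
      obtain ⟨R, R', hR, rfl, hs'⟩ := ih₁ hs
      exact ⟨R, R', hR, rfl, fun k' => .sum2 _ (hs' k')⟩
    | sum2 _ hs =>
      obtain ⟨R, R', hR, rfl, hs'⟩ := ih₂ hs
      exact ⟨R, R', hR, rfl, fun k' => .sum1 _ (hs' k')⟩
  | par h₁ h₂ ih₁ ih₂ =>
    cases hs with
    | par1 _ hs =>
      obtain ⟨R, R', hR, rfl, hs'⟩ := ih₁ hs
      refine ⟨_, _, .par hR h₂, PMF.pure_map _ _, fun k' => ?_⟩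
      simpa only [PMF.pure_map] using Step.par1 _ (hs' k')
    | par2 _ hs =>
      obtain ⟨R, R', hR, rfl, hs'⟩ := ih₂ hs
      refine ⟨_, _, .par h₁ hR, PMF.pure_map _ _, fun k' => ?_⟩
      simpa only [PMF.pure_map] using Step.par2 _ (hs' k')
    | com1 _ _ => exact absurd rfl hα
    | com2 _ _ => exact absurd rfl hα
  | prob _ _ _ _ _ => cases hs; exact absurd rfl hα
  | nus has _ ih =>
    obtain ⟨⟨μ', hs₀, rfl⟩, hα'⟩ := step_nus.1 hs
    obtain ⟨R, R', hR, rfl, hs'⟩ := ih hs₀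
    refine ⟨_, _, .nus has hR, PMF.pure_map _ _, fun k' => ?_⟩
    exact step_nus.2 ⟨⟨_, hs' k', by rw [PMF.pure_map]⟩, act_rename_restricted hφ has hα'⟩

theorem step (hφ : Function.Involutive φ) (hQ : Renamed φ Q Q') (hs : Step I Q h k α μ) (k' : K) :
    ∃ μ', Step I Q' h k' (α.rename φ) μ' ∧
      Coupled (fun x y => Renamed φ x.1 y.1 ∧ x.2 = k ∧ y.2 = k') μ μ' := by
  induction hQ generalizing h α μ with
  | nil => cases hs
  | pre l β hQ _ => cases hs; exact ⟨_, .act _ _ _ _, .pure ⟨hQ, rfl, rfl⟩⟩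
  | plus _ _ ih₁ ih₂ =>
    cases hs with
    | sum1 _ hs =>
      obtain ⟨μ', hs', hc⟩ := ih₁ hs
      exact ⟨μ', .sum1 _ hs', hc⟩
    | sum2 _ hs =>
      obtain ⟨μ', hs', hc⟩ := ih₂ hs
      exact ⟨μ', .sum2 _ hs', hc⟩
  | plus_swap _ _ ih₁ ih₂ =>
    cases hs with
    | sum1 _ hs =>
      obtain ⟨μ', hs', hc⟩ := ih₁ hs
      exact ⟨μ', .sum2 _ hs', hc⟩
    | sum2 _ hs =>
      obtain ⟨μ', hs', hc⟩ := ih₂ hs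
      exact ⟨μ', .sum1 _ hs', hc⟩
  | par h₁ h₂ ih₁ ih₂ =>
    cases hs with
    | par1 _ hs =>
      obtain ⟨μ', hs', hc⟩ := ih₁ hs
      exact ⟨_, .par1 _ hs', hc.map fun _ _ hxy => ⟨.par hxy.1 h₂, hxy.2⟩⟩
    | par2 _ hs =>
      obtain ⟨μ', hs', hc⟩ := ih₂ hs
      exact ⟨_, .par2 _ hs', hc.map fun _ _ hxy => ⟨.par h₁ hxy.1, hxy.2⟩⟩
    | com1 hi ho =>
      obtain ⟨R₁, R₁', hR₁, e₁, hi'⟩ := h₁.step_visible hφ hi (by simp)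
      cases pmf_pure_inj e₁
      obtain ⟨R₂, R₂', hR₂, e₂, ho'⟩ := h₂.step_visible hφ ho (by simp)
      cases pmf_pure_inj e₂
      exact ⟨_, .com1 (hi' k') (ho' k'), .pure ⟨.par hR₁ hR₂, rfl, rfl⟩⟩
    | com2 hi ho =>
      obtain ⟨R₁, R₁', hR₁, e₁, hi'⟩ := h₂.step_visible hφ hi (by simp)
      cases pmf_pure_inj e₁
      obtain ⟨R₂, R₂', hR₂, e₂, ho'⟩ := h₁.step_visible hφ ho (by simp)
      cases pmf_pure_inj e₂
      exact ⟨_, .com2 (hi' k') (ho' k'), .pure ⟨.par hR₂ hR₁, rfl, rfl⟩⟩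
  | prob l e hp hQ _ =>
    cases hs
    refine ⟨_, .prob _ _ _ _ _, ?_⟩
    -- Both measures are now images of `p`; the coupling draws one index `i` and pairs branch `i`
    -- with branch `e i`.
    rw [← hp, PMF.map_comp]
    exact .map_same _ fun i => ⟨hQ i, rfl, rfl⟩
  | nus has _ ih =>
    obtain ⟨⟨μ₀, hs₀, rfl⟩, hα'⟩ := step_nus.1 hs
    obtain ⟨μ', hs', hc⟩ := ih hs₀
    exact ⟨_, step_nus.2 ⟨⟨_, hs', rfl⟩, act_rename_restricted hφ has hα'⟩,
      hc.map fun _ _ hxy => ⟨.nus has hxy.1, hxy.2⟩⟩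

end Renamed

/-- Like `Renamed`, for processes in which the master has not yet chosen the payer. -/
inductive RenamedMaster (φ : Chan → Chan) : P → P → Prop
  | master : RenamedMaster φ master master
  | par {Q Q' R R' : P} :
      RenamedMaster φ Q Q' → Renamed φ R R' → RenamedMaster φ (.par Q R) (.par Q' R')
  | nus {as as' : List Chan} {Q Q' : P} :
      (∀ a, a ∈ as ↔ φ a ∈ as') → RenamedMaster φ Q Q' →
      RenamedMaster φ (Proc.nus as Q) (Proc.nus as' Q')

/-- The relation between the states of the protocol under the independent schedulers `T₁` and
`T₂`: as long as the master has not chosen the payer, the independent schedulers are these. -/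
def StateRel (φ : Chan → Chan) (T₁ T₂ : Sched Lab) (x y : P × Scheds) : Prop :=
  x.2.1 = y.2.1 ∧ (Renamed φ x.1 y.1 ∨ (RenamedMaster φ x.1 y.1 ∧ x.2.2 = T₁ ∧ y.2.2 = T₂))

theorem Selects.unique {T T' : Sched Lab} {i j : Fin 3} (hT : Selects T i)
    (h : Trans₁ choice T .tau (PMF.pure (messages j, T'))) : messages j = messages i := by
  obtain ⟨T'', h'⟩ := hT
  exact (Prod.mk.inj (pmf_pure_inj (trans_choice_det h h').2)).1

namespace RenamedMaster

variable {φ : Chan → Chan} {Q Q' : P} {h : Sel Lab} {α : Act Chan}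
  {S T₁ T₂ : Sched Lab} {i j : Fin 3}

theorem symm (hφ : Function.Involutive φ) (hQ : RenamedMaster φ Q Q') :
    RenamedMaster φ Q' Q := by
  induction hQ with
  | master => exact .master
  | par _ h₂ ih => exact .par ih (h₂.symm hφ)
  | nus has _ ih => exact .nus (fun a => by rw [has, hφ a]) ih

theorem step_visible (hφ : Function.Involutive φ) (hQ : RenamedMaster φ Q Q') {k : Scheds}
    {μ : PMF (P × Scheds)} (hs : Step Indep Q h k α μ)
    (hα : α ≠ .tau) : ∃ R R', RenamedMaster φ R R' ∧ μ = PMF.pure (R, k) ∧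
      ∀ k', Step Indep Q' h k' (α.rename φ) (PMF.pure (R', k')) := by
  induction hQ generalizing μ with
  | master => exact absurd (step_master hs).2.1 hα
  | par h₁ h₂ ih =>
    cases hs with
    | par1 _ hs =>
      obtain ⟨R, R', hR, rfl, hs'⟩ := ih hs
      refine ⟨_, _, .par hR h₂, PMF.pure_map _ _, fun k' => ?_⟩
      simpa only [PMF.pure_map] using Step.par1 _ (hs' k')
    | par2 _ hs =>
      obtain ⟨R, R', hR, rfl, hs'⟩ := h₂.step_visible hφ hs hα
      refine ⟨_, _, .par h₁ hR, PMF.pure_map _ _, fun k' => ?_⟩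
      simpa only [PMF.pure_map] using Step.par2 _ (hs' k')
    | com1 _ _ => exact absurd rfl hα
    | com2 _ _ => exact absurd rfl hα
  | nus has _ ih =>
    obtain ⟨⟨μ', hs₀, rfl⟩, hα'⟩ := step_nus.1 hs
    obtain ⟨R, R', hR, rfl, hs'⟩ := ih hs₀
    refine ⟨_, _, .nus has hR, PMF.pure_map _ _, fun k' => ?_⟩
    exact step_nus.2 ⟨⟨_, hs' k', by rw [PMF.pure_map]⟩, act_rename_restricted hφ has hα'⟩

/-- The choice of the master is the one step at which the two sides cease to be related by
`RenamedMaster`; from then on `Renamed` holds and the remaining independent schedulers are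
irrelevant. -/
theorem step (hφ : Function.Involutive φ) (hT₁ : Selects T₁ i) (hT₂ : Selects T₂ j)
    (hij : Renamed φ (messages i) (messages j)) (hQ : RenamedMaster φ Q Q')
    {μ : PMF (P × Scheds)} (hs : Step Indep Q h (S, T₁) α μ) :
    ∃ μ', Step Indep Q' h (S, T₂) (α.rename φ) μ' ∧ Coupled (StateRel φ T₁ T₂) μ μ' := by
  induction hQ generalizing h α μ with
  | master =>
    obtain ⟨rfl, rfl, i', T', rfl, hT⟩ := step_master hs
    obtain ⟨T'', hT'⟩ := hT₂
    refine ⟨PMF.pure (messages j, S, T''), ?_, .pure ⟨rfl, .inl ?_⟩⟩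
    · have := Indep.mk (S := S) hT'
      rw [PMF.pure_map] at this
      exact .indep this
    -- The payer `i'` of the given step has the same messages as `i`, since `T₁` resolves the choice
    -- in only one way.
    · rwa [hT₁.unique hT]
  | par h₁ h₂ ih =>
    cases hs with
    | par1 _ hs =>
      obtain ⟨μ', hs', hc⟩ := ih hs
      refine ⟨_, .par1 _ hs', hc.map fun x y hxy => ⟨hxy.1, hxy.2.imp ?_ ?_⟩⟩
      · exact fun hr => .par hr h₂
      · exact fun hr => ⟨.par hr.1 h₂, hr.2⟩
    | par2 _ hs =>
      obtain ⟨μ', hs', hc⟩ := h₂.step hφ hs (S, T₂)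
      refine ⟨_, .par2 _ hs', hc.map ?_⟩
      rintro ⟨x, _⟩ ⟨y, _⟩ ⟨hxy, rfl, rfl⟩
      exact ⟨rfl, .inr ⟨.par h₁ hxy, rfl, rfl⟩⟩
    | com1 hi ho =>
      obtain ⟨R₁, R₁', hR₁, e₁, hi'⟩ := h₁.step_visible hφ hi (by simp)
      cases pmf_pure_inj e₁
      obtain ⟨R₂, R₂', hR₂, e₂, ho'⟩ := h₂.step_visible hφ ho (by simp)
      cases pmf_pure_inj e₂
      exact ⟨_, .com1 (hi' _) (ho' _), .pure ⟨rfl, .inr ⟨.par hR₁ hR₂, rfl, rfl⟩⟩⟩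
    | com2 hi ho =>
      obtain ⟨R₁, R₁', hR₁, e₁, hi'⟩ := h₂.step_visible hφ hi (by simp)
      cases pmf_pure_inj e₁
      obtain ⟨R₂, R₂', hR₂, e₂, ho'⟩ := h₁.step_visible hφ ho (by simp)
      cases pmf_pure_inj e₂
      exact ⟨_, .com2 (hi' _) (ho' _), .pure ⟨rfl, .inr ⟨.par hR₂ hR₁, rfl, rfl⟩⟩⟩
  | nus has _ ih =>
    obtain ⟨⟨μ₀, hs₀, rfl⟩, hα'⟩ := step_nus.1 hs
    obtain ⟨μ', hs', hc⟩ := ih hs₀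
    refine ⟨_, step_nus.2 ⟨⟨_, hs', rfl⟩, act_rename_restricted hφ has hα'⟩,
      hc.map fun x y hxy => ⟨hxy.1, hxy.2.imp ?_ ?_⟩⟩
    · exact fun hr => .nus has hr
    · exact fun hr => ⟨.nus has hr.1, hr.2⟩

end RenamedMaster

namespace StateRel

variable {φ : Chan → Chan} {T₁ T₂ : Sched Lab} {i j : Fin 3}

theorem symm (hφ : Function.Involutive φ) {x y : P × Scheds} (h : StateRel φ T₁ T₂ x y) :
    StateRel φ T₂ T₁ y x :=
  ⟨h.1.symm, h.2.imp (·.symm hφ) fun hr => ⟨hr.1.symm hφ, hr.2.2, hr.2.1⟩⟩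

theorem step (hφ : Function.Involutive φ) (hT₁ : Selects T₁ i) (hT₂ : Selects T₂ j)
    (hij : Renamed φ (messages i) (messages j)) {x y : P × Scheds} (hxy : StateRel φ T₁ T₂ x y)
    {h : Sel Lab} {S : Sched Lab} {α : Act Chan} {μ : PMF (P × Scheds)}
    (hs : Step Indep x.1 h (S, x.2.2) α μ) :
    ∃ μ', Step Indep y.1 h (S, y.2.2) (α.rename φ) μ' ∧ Coupled (StateRel φ T₁ T₂) μ μ' := by
  obtain ⟨Q, S₁, U₁⟩ := x
  obtain ⟨Q', S₂, U₂⟩ := y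
  obtain ⟨_, hr | ⟨hr, rfl, rfl⟩⟩ := hxy
  · obtain ⟨μ', hs', hc⟩ := hr.step hφ hs (S, U₂)
    refine ⟨μ', hs', hc.mono ?_⟩
    rintro ⟨x, _⟩ ⟨y, _⟩ ⟨hxy, rfl, rfl⟩
    exact ⟨rfl, .inl hxy⟩
  · exact hr.step hφ hT₁ hT₂ hij hs

theorem trans (hφ : Function.Involutive φ) (hT₁ : Selects T₁ i) (hT₂ : Selects T₂ j)
    (hij : Renamed φ (messages i) (messages j)) {x y : P × Scheds} (hxy : StateRel φ T₁ T₂ x y)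
    {α : Act Chan} {μ : PMF (P × Scheds)} (ht : Trans₂ x.1 x.2.1 x.2.2 α μ) :
    ∃ μ', Trans₂ y.1 y.2.1 y.2.2 (α.rename φ) μ' ∧ Coupled (StateRel φ T₁ T₂) μ μ' := by
  rw [Trans₂, hxy.1] at ht
  refine Resolve.transfer (R := fun h S β ν => Step Indep x.1 h (S, x.2.2) β ν)
    (f := Act.rename φ) (fun h S α μ hs => hxy.step hφ hT₁ hT₂ hij hs)
    (fun h S α μ hs => ?_) ht
  obtain ⟨ν, hs', _⟩ := (hxy.symm hφ).step hφ hT₂ hT₁ (hij.symm hφ) hs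
  exact ⟨_, ν, hs'⟩

end StateRel

/-! ## Flipping the messages and the coins -/

/-- The renaming that adds `f i` to the messages to cryptographer `i` and `g i` to coin `i`. -/
def flip (f g : Fin 3 → ZMod 2) : Chan → Chan
  | .m i v => .m i (v + f i)
  | .c i j v => .c i j (v + g j)
  | .out i v => .out i v

theorem eq_zero_or_eq_one : ∀ b : ZMod 2, b = 0 ∨ b = 1 := by
  decide

theorem add_add_self (v f : ZMod 2) : v + f + f = v := by
  rw [add_assoc, CharTwo.add_self_eq_zero, add_zero]

theorem flip_involutive (f g : Fin 3 → ZMod 2) : Function.Involutive (flip f g) := by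
  rintro (⟨i, v⟩ | ⟨i, j, v⟩ | ⟨i, v⟩) <;> simp [flip, add_add_self]

theorem map_announce (f g : Fin 3 → ZMod 2) (o : List (Fin 3 × ZMod 2)) :
    (o.map announce).map (Act.rename (flip f g)) = o.map announce := by
  rw [List.map_map]
  rfl

variable {φ : Chan → Chan}

theorem renamed_send (l : Lab) {c : ZMod 2 → Chan} {v v' : ZMod 2} (h : φ (c v) = c v') :
    Renamed φ (send l c v) (send l c v') := by
  unfold send
  rw [← h]
  exact .pre _ (.out _) .nil

/-- Adding 1 to the received bit exchanges the two summands, which carry the same label. -/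
theorem renamed_recv (l : Lab) {c : ZMod 2 → Chan} {b : ZMod 2} (hc : ∀ v, φ (c v) = c (v + b))
    {Q Q' : ZMod 2 → P} (hQ : ∀ v, Renamed φ (Q v) (Q' (v + b))) :
    Renamed φ (recv l c Q) (recv l c Q') := by
  have hpre : ∀ v, Renamed φ (.pre (Label.plain l) (.inp (c v)) (Q v))
      (.pre (Label.plain l) (.inp (c (v + b))) (Q' (v + b))) := fun v => by
    rw [← hc]
    exact .pre _ (.inp _) (hQ v)
  have h₀ := hpre 0
  have h₁ := hpre 1
  rcases eq_zero_or_eq_one b with rfl | rfl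
  · exact .plus h₀ h₁
  · exact .plus_swap h₀ h₁

variable {f g : Fin 3 → ZMod 2}

theorem renamed_messages {i j : Fin 3} (h : ∀ n, eqBit i n + f n = eqBit j n) :
    Renamed (flip f g) (messages i) (messages j) :=
  .par (.par (renamed_send _ (by rw [flip, h])) (renamed_send _ (by rw [flip, h])))
    (renamed_send _ (by rw [flip, h]))

/-- The three received bits change by `f i`, `g i` and `g (i + 1)`, so by `h` the announced sum does
not change. -/
theorem renamed_crypt (h : ∀ i, f i + g i + g (i + 1) = 0) (i : Fin 3) :
    Renamed (flip f g) (crypt i) (crypt i) := by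
  refine renamed_recv (b := f i) _ (fun _ => rfl) fun pay =>
    renamed_recv (b := g i) _ (fun _ => rfl) fun x =>
      renamed_recv (b := g (i + 1)) _ (fun _ => rfl) fun y => renamed_send _ ?_
  rw [flip]
  congr 1
  linear_combination -h i

/-- The second index of `Chan.c` is the coin, so both outputs of coin `i` are shifted by `g i`.
Fairness enters here: the uniform distribution is invariant under the swap. -/
theorem renamed_coin (i : Fin 3) : Renamed (flip f g) (coin i) (coin i) := by
  have hbranch : ∀ v, Renamed (flip f g)
      (.par (send (.l10 i) (Chan.c i i) v) (send (.l11 i) (Chan.c (i - 1) i) v))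
      (.par (send (.l10 i) (Chan.c i i) (v + g i))
        (send (.l11 i) (Chan.c (i - 1) i) (v + g i))) := fun v =>
    .par (renamed_send _ rfl) (renamed_send _ rfl)
  have h₀ := hbranch 0
  have h₁ := hbranch 1
  rcases eq_zero_or_eq_one (g i) with hg | hg
  · rw [hg] at h₀ h₁
    refine .prob _ (Equiv.refl _) (PMF.map_id _) fun b => ?_
    fin_cases b
    · exact h₀
    · exact h₁
  · rw [hg] at h₀ h₁
    refine .prob _ (Equiv.swap 0 1) ?_ fun b => ?_
    · ext b
      simp only [PMF.map_apply, PMF.uniformOfFintype_apply]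
      rw [tsum_eq_single ((Equiv.swap 0 1).symm b)]
      · simp
      · intro b' hb'
        rw [if_neg]
        rintro rfl
        simp at hb'
    · fin_cases b
      · exact h₀
      · exact h₁

theorem renamed_prot (h : ∀ i, f i + g i + g (i + 1) = 0) :
    RenamedMaster (flip f g) prot prot := by
  refine .nus (fun a => ?_) (.par .master (.nus (fun a => ?_)
    (.par (.par (.par (renamed_crypt h 0) (renamed_crypt h 1)) (renamed_crypt h 2))
      (.par (.par (renamed_coin 0) (renamed_coin 1)) (renamed_coin 2)))))
  · rw [mem_mChans, mem_mChans]
    cases a <;> simp [flip]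
  · rw [mem_cChans, mem_cChans]
    cases a with
    | m i v => simp [flip]
    | c i j v => simp [flip, exists_or]
    | out i v => simp [flip]

/-- The coins can be flipped in such a way that the announcements hide a change of the payer. -/
theorem exists_coins (i j : Fin 3) :
    ∃ g : Fin 3 → ZMod 2, ∀ n, eqBit i n + eqBit j n + g n + g (n + 1) = 0 := by
  -- A solution exists because each coin is seen by two cryptographers: the `g` terms cancel around
  -- the cycle, and the `eqBit` terms also sum to `1 + 1 = 0`. The finitely many cases are checked
  -- by evaluation.
  revert i j
  decide

theorem obsProb_eq {T₁ T₂ : Sched Lab} {i j : Fin 3} (hT₁ : Selects T₁ i) (hT₂ : Selects T₂ j)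
    (S : Sched Lab) (o : List (Fin 3 × ZMod 2)) : obsProb S T₁ o = obsProb S T₂ o := by
  obtain ⟨g, hg⟩ := exists_coins i j
  have hφ := flip_involutive (fun n => eqBit i n + eqBit j n) g
  have hij : Renamed (flip (fun n => eqBit i n + eqBit j n) g) (messages i) (messages j) :=
    renamed_messages fun n => by rw [add_comm, add_right_comm, CharTwo.add_self_eq_zero, zero_add]
  refine traceProb_eq_of_bisim (R := StateRel _ T₁ T₂) hφ
    (wellLabelled_prot.fullyProbabilistic S T₁) (wellLabelled_prot.fullyProbabilistic S T₂)
    (fun x y α μ hxy ht => hxy.trans hφ hT₁ hT₂ hij ht) (fun x y α μ hxy ht => ?_)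
    ⟨rfl, .inr ⟨renamed_prot hg, rfl, rfl⟩⟩ (map_announce _ _ o)
  obtain ⟨ν, ht', _⟩ := (hxy.symm hφ).trans hφ hT₂ hT₁ (hij.symm hφ) ht
  exact ⟨_, ν, ht'⟩

end DCP

end CCS

theorem mainTheorem6 :
    (∀ S T : CCS.Sched CCS.DCP.Lab,
      (CCS.automaton CCS.DCP.prot S T).FullyProbabilistic) ∧
    ∀ (o : List (Fin 3 × ZMod 2)) (S T₁ T₂ : CCS.Sched CCS.DCP.Lab) (i j : Fin 3),
      CCS.DCP.Selects T₁ i → CCS.DCP.Selects T₂ j → i ≠ j →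
      CCS.DCP.obsProb S T₁ o = CCS.DCP.obsProb S T₂ o :=
  ⟨CCS.DCP.wellLabelled_prot.fullyProbabilistic,
    fun o S _ _ _ _ hT₁ hT₂ _ => CCS.DCP.obsProb_eq hT₁ hT₂ S o⟩
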